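/- Let $G$ be a (finite-dimensional, real) Lie group with Lie algebra $\mathfrak g$, let $M$ be a smooth manifold, and let $p\colon P\to M$ be a $G$-equivariant principal $U(1)$-bundle: a smooth principal $U(1)$-bundle on which $G$ acts smoothly from the left by principal bundle automorphisms covering an action of $G$ on $M$. Write $\phi_P$, $\phi_M$ for the actions of $\phi\in G$, and for $X\in\mathfrak g$ put $X_P(y)=\frac{d}{dt}\big|_{t=0}\exp(-tX)_P(y)$. Let $\Xi\in\Omega^1(P,i\mathbb R)$ be a $G$-invariant connection form (normalised by $\Xi(\frac{d}{dt}|_{t=0}\,y\cdot e^{it})=i$). The momentum of $\Xi$ is the function $\mu^\Xi_X\colon M\to\mathbb R$ onto which $-\frac{i}{2\pi}\,\Xi(X_P)$ projects. For $\phi\in G$ and $x\in M$ let $\mathcal C^\phi_x(M)$ be the set of piecewise $\mathcal C^1$ curves $\gamma\colon[0,1]\to M$ with $\gamma(0)=x$ and $\gamma(1)=\phi_M(x)$. For such $\gamma$ the equivariant holonomy $\mathrm{Hol}^\Xi_\phi(\gamma)\in U(1)$ is the element determined by $\overline\gamma^{\,y}(1)=\phi_P(y)\cdot \mathrm{Hol}^\Xi_\phi(\gamma)$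 for every $y\in p^{-1}(x)$, where $\overline\gamma^{\,y}$ is the $\Xi$-horizontal lift of $\gamma$ with $\overline\gamma^{\,y}(0)=y$. For every $X\in\mathfrak g$ and $x\in M$, the curve $\tau_{x,X}(s)=\exp(sX)_M(x)$, $s\in[0,1]$, belongs to $\mathcal C^{\exp X}_x(M)$, its equivariant holonomy is well defined (horizontal lifts exist from every $y\in p^{-1}(x)$, and all end at $\exp(X)_P(y)\cdot u$ for one and the same $u\in U(1)$), and $$\mathrm{Hol}^\Xi_{\exp X}(\tau_{x,X})=\exp\bigl(2\pi i\,\mu^\Xi_X(x)\bigr).$$ -/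

import Mathlib

open Set Bundle
open scoped Manifold ContDiff

noncomputable section EquivariantHolonomy

/-! ### The exponential map of a Lie group -/

section Exponential

variable {EG : Type*} [NormedAddCommGroup EG] [NormedSpace ℝ EG]
  {HG : Type*} [TopologicalSpace HG] (IG : ModelWithCorners ℝ EG HG)
  {G : Type*} [TopologicalSpace G] [ChartedSpace HG G] [Group G] [LieGroup IG ∞ G]

theorem contMDiff_leftInvariantField (X : GroupLieAlgebra IG G) :
    ContMDiff IG IG.tangent 1
      (fun g : G => (⟨g, mulInvariantVectorField X g⟩ : TangentBundle IG G)) := by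
  have : LieGroup IG (minSmoothness ℝ 3) G := by
    rw [minSmoothness_of_isRCLikeNormedField]; infer_instance
  exact (contMDiff_mulInvariantVectorField X).of_le (by
      rw [minSmoothness_of_isRCLikeNormedField]; exact one_le_two)

theorem mfderiv_mul_left_leftInvariantField (X : GroupLieAlgebra IG G) (g h : G) :
    mfderiv IG IG (fun k => g * k) h (mulInvariantVectorField X h)
      = mulInvariantVectorField X (g * h) := by
  have hL : ∀ a : G, MDifferentiable IG IG (fun k : G => a * k) := fun a =>
    (contMDiff_mul_left (I := IG) (n := ∞) (a := a)).mdifferentiable (by simp)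
  have e : (fun k : G => g * h * k) = (fun k => g * k) ∘ (fun k => h * k) := by
    ext k; simp [mul_assoc]
  unfold mulInvariantVectorField
  rw [e, mfderiv_comp (I' := IG) _ (hL g _) (hL h _), mul_one]
  rfl

variable [FiniteDimensional ℝ EG] [T2Space G] [BoundarylessManifold IG G]

/-- Left-invariant vector fields are complete: there is a global integral curve through `1`. -/
theorem exists_oneParameterCurve (X : GroupLieAlgebra IG G) :
    ∃ γ : ℝ → G, γ 0 = 1 ∧ IsMIntegralCurve (I := IG) γ (mulInvariantVectorField X) := by
  have : CompleteSpace EG := FiniteDimensional.complete ℝ EG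
  have : IsManifold IG 1 G := inferInstance
  have hv := contMDiff_leftInvariantField IG (G := G) X
  obtain ⟨γ, hγ0, hγ⟩ := exists_isMIntegralCurveAt_of_contMDiffAt_boundaryless
    (t₀ := (0 : ℝ)) (hv.contMDiffAt (x := (1 : G)))
  obtain ⟨ε, hε, hγ⟩ := isMIntegralCurveAt_iff'.1 hγ
  rw [Real.ball_eq_Ioo, zero_sub, zero_add] at hγ
  refine exists_isMIntegralCurve_of_isMIntegralCurveOn hv hε (fun g => ?_) 1
  refine ⟨fun t => g * γ t, by simp [hγ0], fun t ht => ?_⟩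
  have hL : HasMFDerivAt IG IG (fun k => g * k) (γ t) (mfderiv IG IG (fun k => g * k) (γ t)) :=
    ((contMDiff_mul_left (I := IG) (n := ∞) (a := g)).mdifferentiable (by simp) _).hasMFDerivAt
  have h1 := hL.comp_hasMFDerivWithinAt t (hγ t ht)
  have h2 : (mfderiv IG IG (fun k => g * k) (γ t)).comp
      ((1 : ℝ →L[ℝ] ℝ).smulRight (mulInvariantVectorField X (γ t)))
      = (1 : ℝ →L[ℝ] ℝ).smulRight (mulInvariantVectorField X (g * γ t)) := by
    apply ContinuousLinearMap.ext
    intro s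
    rw [← mfderiv_mul_left_leftInvariantField]
    exact map_smul (mfderiv IG IG (fun k => g * k) (γ t)) s _
  exact h2 ▸ h1

/-- The one-parameter subgroup generated by `X`: the integral curve through `1` of the
left-invariant vector field of `X`. -/
def oneParameterCurve (X : GroupLieAlgebra IG G) : ℝ → G :=
  (exists_oneParameterCurve IG X).choose

/-- The exponential map `exp : 𝔤 → G` of the Lie group `G`. -/
def lieExp (X : GroupLieAlgebra IG G) : G := oneParameterCurve IG X 1

theorem lieExp_smul (X : GroupLieAlgebra IG G) (t : ℝ) :
    lieExp IG (t • X) = oneParameterCurve IG X t := by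
  have : IsManifold IG 1 G := inferInstance
  have h1 := (exists_oneParameterCurve IG X).choose_spec
  have h2 := (exists_oneParameterCurve IG (t • X)).choose_spec
  have h3 := h1.2.comp_mul t
  rw [← mulInvariantVectorField_smul] at h3
  have h4 := isMIntegralCurve_Ioo_eq_of_contMDiff_boundaryless (t₀ := (0 : ℝ))
    (contMDiff_leftInvariantField IG (G := G) (t • X)) h2.2 h3 (by simp [h2.1, h1.1])
  have h5 := congrFun h4 1
  simp only [Function.comp, one_mul] at h5
  exact h5

end Exponential

/-! ### Equivariant `U(1)`-bundles with invariant connection -/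

section Bundle

variable {EM : Type*} [NormedAddCommGroup EM] [NormedSpace ℝ EM]
  {HM : Type*} [TopologicalSpace HM] (IM : ModelWithCorners ℝ EM HM)
  {M : Type*} [TopologicalSpace M] [ChartedSpace HM M]
  {EP : Type*} [NormedAddCommGroup EP] [NormedSpace ℝ EP]
  {HP : Type*} [TopologicalSpace HP] (IP : ModelWithCorners ℝ EP HP)
  {P : Type*} [TopologicalSpace P] [ChartedSpace HP P] [MulAction Circle P]

/-- `p : P → M` is a smooth principal `U(1)`-bundle. As `U(1)` is commutative, the principal right
action `y · u` is written as the left action `u • y`. The bundle has smooth local trivializations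
`p⁻¹(V) ≃ V × U(1)` over open sets `V` that intertwine the action with multiplication in `U(1)`. -/
structure IsPrincipalCircleBundle (p : P → M) : Prop where
  contMDiff_smul : ContMDiff ((𝓡 1).prod IP) IP ∞ (fun q : Circle × P => q.1 • q.2)
  proj_smul : ∀ (u : Circle) (y : P), p (u • y) = p y
  locally_trivial : ∀ x : M, ∃ e : Trivialization Circle p, x ∈ e.baseSet ∧
    ContMDiffOn IP (IM.prod (𝓡 1)) ∞ e.toOpenPartialHomeomorph e.source ∧
    ContMDiffOn (IM.prod (𝓡 1)) IP ∞ e.toOpenPartialHomeomorph.symm e.target ∧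
    ∀ y ∈ e.source, ∀ u : Circle,
      (e.toOpenPartialHomeomorph (u • y)).2 = u * (e.toOpenPartialHomeomorph y).2

variable {IM IP} in
theorem IsPrincipalCircleBundle.exists_proj_eq {p : P → M}
    (hp : IsPrincipalCircleBundle IM IP p) (x : M) : ∃ y : P, p y = x := by
  obtain ⟨e, hx, -⟩ := hp.locally_trivial x
  exact ⟨_, e.proj_symm_apply' (x := (1 : Circle)) hx⟩

/-- `p : P → M` is a `G`-equivariant `U(1)`-bundle: a principal `U(1)`-bundle on which the Lie group
`G` acts smoothly from the left by principal bundle automorphisms covering the action on `M`. -/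
structure IsEquivariantCircleBundle
    {EG : Type*} [NormedAddCommGroup EG] [NormedSpace ℝ EG]
    {HG : Type*} [TopologicalSpace HG] (IG : ModelWithCorners ℝ EG HG)
    (G : Type*) [TopologicalSpace G] [ChartedSpace HG G] [Group G]
    [MulAction G M] [MulAction G P] (p : P → M) : Prop
    extends IsPrincipalCircleBundle IM IP p where
  contMDiff_action : ContMDiff (IG.prod IP) IP ∞ (fun q : G × P => q.1 • q.2)
  action_comm : ∀ (g : G) (u : Circle) (y : P), g • u • y = u • g • y
  proj_action : ∀ (g : G) (y : P), p (g • y) = g • p y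

/-- `Ξ ∈ Ω¹(P, iℝ)` is a connection form on the principal `U(1)`-bundle `P`: a smooth 1-form (that
is, a fibrewise linear smooth function on `TP`) with imaginary values, `U(1)`-invariant, and equal
to `i` on the vector field `d/dt|₀ (y · exp(it))`. -/
structure IsConnectionForm [IsManifold IP ∞ P] (Ξ : (y : P) → TangentSpace IP y →L[ℝ] ℂ) : Prop where
  smooth : ContMDiff IP.tangent 𝓘(ℝ, ℂ) ∞ (fun v : TangentBundle IP P => Ξ v.proj v.snd)
  imaginary : ∀ (y : P) (v : TangentSpace IP y), (Ξ y v).re = 0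
  invariant : ∀ (u : Circle) (y : P) (v : TangentSpace IP y),
    Ξ (u • y) (mfderiv IP IP (fun z : P => u • z) y v) = Ξ y v
  vertical : ∀ y : P,
    Ξ y (mfderiv 𝓘(ℝ, ℝ) IP (fun t : ℝ => Circle.exp t • y) 0 (1 : ℝ)) = Complex.I

/-- The 1-form `Ξ` on `P` is `G`-invariant: `(φ_P)^* Ξ = Ξ` for every `φ ∈ G`. -/
def IsInvariantForm (G : Type*) [Group G] [MulAction G P]
    (Ξ : (y : P) → TangentSpace IP y →L[ℝ] ℂ) : Prop :=
  ∀ (g : G) (y : P) (v : TangentSpace IP y),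
    Ξ (g • y) (mfderiv IP IP (fun z : P => g • z) y v) = Ξ y v

/-! ### Curves, horizontal lifts and equivariant holonomy -/

/-- A curve `γ : [0,1] → M` is piecewise `C¹`: it is continuous and there are
`0 = t₀ < t₁ < ⋯ < tₙ = 1` such that `γ` is `C¹` on each closed interval `[tᵢ, tᵢ₊₁]`. -/
def IsPiecewiseC1 (γ : unitInterval → M) : Prop :=
  Continuous γ ∧ ∃ (n : ℕ) (t : ℕ → ℝ), t 0 = 0 ∧ t n = 1 ∧
    ∀ i < n, t i < t (i + 1) ∧
      ContMDiffOn 𝓘(ℝ, ℝ) IM 1 (IccExtend zero_le_one γ) (Icc (t i) (t (i + 1)))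

/-- The space `𝒞^φ_x(M)` of piecewise `C¹` curves `γ : [0,1] → M` with `γ(0) = x` and
`γ(1) = φ_M(γ(0))`. -/
def equivariantCurves {G : Type*} [Group G] [MulAction G M] (φ : G) (x : M) :
    Set (unitInterval → M) :=
  {γ | IsPiecewiseC1 IM γ ∧ γ 1 = φ • γ 0 ∧ γ 0 = x}

/-- `c : [0,1] → P` is the `Ξ`-horizontal lift of `γ` starting at `y`: it is piecewise `C¹`,
projects onto `γ`, starts at `y`, and `Ξ(ċ(t)) = 0` wherever `c` is differentiable. -/
structure IsHorizontalLift (p : P → M) (Ξ : (y : P) → TangentSpace IP y →L[ℝ] ℂ)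
    (γ : unitInterval → M) (y : P) (c : unitInterval → P) : Prop where
  piecewiseC1 : IsPiecewiseC1 IP c
  proj : ∀ t, p (c t) = γ t
  initial : c 0 = y
  horizontal : ∀ t ∈ Ioo (0 : ℝ) 1,
    MDifferentiableAt 𝓘(ℝ, ℝ) IP (IccExtend zero_le_one c) t →
    Ξ (IccExtend zero_le_one c t)
      (mfderiv 𝓘(ℝ, ℝ) IP (IccExtend zero_le_one c) t (1 : ℝ)) = 0

/-- The defining property of the `φ`-equivariant holonomy `u` of `γ`: for every `y` over `γ(0)`
there is a horizontal lift `γ̄^y` of `γ` starting at `y`, and `γ̄^y(1) = φ_P(y) · u`. -/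
def IsEquivariantHolonomy {G : Type*} [Group G] [MulAction G P]
    (p : P → M) (Ξ : (y : P) → TangentSpace IP y →L[ℝ] ℂ)
    (φ : G) (γ : unitInterval → M) (u : Circle) : Prop :=
  ∀ y : P, p y = γ 0 →
    (∃ c, IsHorizontalLift IP p Ξ γ y c) ∧
    ∀ c, IsHorizontalLift IP p Ξ γ y c → c 1 = u • φ • y

open Classical in
/-- The `φ`-equivariant holonomy `Hol^Ξ_φ(γ) ∈ U(1)` of a curve `γ` (with the value `1` if no
element has the defining property, which never happens for `γ ∈ 𝒞^φ(M)`). -/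
def equivariantHolonomy {G : Type*} [Group G] [MulAction G P]
    (p : P → M) (Ξ : (y : P) → TangentSpace IP y →L[ℝ] ℂ)
    (φ : G) (γ : unitInterval → M) : Circle :=
  if h : ∃ u : Circle, IsEquivariantHolonomy IP p Ξ φ γ u then h.choose else 1

/-! ### Fundamental vector fields, momentum and orbit curves -/

variable {EG : Type*} [NormedAddCommGroup EG] [NormedSpace ℝ EG] [FiniteDimensional ℝ EG]
  {HG : Type*} [TopologicalSpace HG] (IG : ModelWithCorners ℝ EG HG)
  {G : Type*} [TopologicalSpace G] [ChartedSpace HG G] [Group G] [LieGroup IG ∞ G]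
  [T2Space G] [BoundarylessManifold IG G]

/-- The fundamental vector field `X_P(y) = d/dt|₀ exp(-tX)_P(y)`. -/
def fundamentalVectorField [MulAction G P] (X : GroupLieAlgebra IG G) (y : P) :
    TangentSpace IP y :=
  mfderiv 𝓘(ℝ, ℝ) IP (fun t : ℝ => lieExp IG (-(t • X)) • y) 0 (1 : ℝ)

/-- The orbit curve `τ_{x,X}(s) = exp(sX)_M(x)`, `s ∈ [0,1]`. -/
def orbitCurve [MulAction G M] (X : GroupLieAlgebra IG G) (x : M) : unitInterval → M :=
  fun s => lieExp IG ((s : ℝ) • X) • x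

/-- The momentum `μ^Ξ_X : M → ℝ`, the function on `M` onto which `-(i/2π) Ξ(X_P)` projects; it is
evaluated at an arbitrary point of the fibre. -/
def momentum [MulAction G M] [MulAction G P] {p : P → M}
    (hp : IsEquivariantCircleBundle IM IP IG G p)
    (Ξ : (y : P) → TangentSpace IP y →L[ℝ] ℂ) (X : GroupLieAlgebra IG G) (x : M) : ℝ :=
  (-(Complex.I / (2 * Real.pi)) *
    Ξ (hp.exists_proj_eq x).choose
      (fundamentalVectorField IP IG X (hp.exists_proj_eq x).choose)).re

/-- The momentum does not depend on the point of the fibre, and `-(i/2π) Ξ(X_P)` is real. -/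
theorem momentum_proj [IsManifold IP ∞ P] [MulAction G M] [MulAction G P] {p : P → M}
    (hp : IsEquivariantCircleBundle IM IP IG G p)
    {Ξ : (y : P) → TangentSpace IP y →L[ℝ] ℂ} (hΞ : IsConnectionForm IP Ξ)
    (X : GroupLieAlgebra IG G) (y : P) :
    (momentum IM IP IG hp Ξ X (p y) : ℂ) =
      -(Complex.I / (2 * Real.pi)) * Ξ y (fundamentalVectorField IP IG X y) := by
  -- two points of a fibre differ by an element of the circle
  have hfib : ∀ z : P, p z = p y → ∃ u : Circle, z = u • y := by
    intro z hz
    obtain ⟨e, hx, -, -, he⟩ := hp.locally_trivial (p y)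
    have hy : y ∈ e.source := by rw [e.source_eq]; exact hx
    have hzs : z ∈ e.source := by rw [e.source_eq, mem_preimage, hz]; exact hx
    set u : Circle := (e.toOpenPartialHomeomorph z).2 * (e.toOpenPartialHomeomorph y).2⁻¹
    refine ⟨u, e.injOn hzs ?_ (Prod.ext ?_ ?_)⟩
    · rw [e.source_eq, mem_preimage, hp.proj_smul]; exact hx
    · refine (e.proj_toFun z hzs).trans (hz.trans ?_)
      rw [← hp.proj_smul u y]
      refine (e.proj_toFun _ ?_).symm
      rw [e.source_eq, mem_preimage, hp.proj_smul]; exact hx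
    · refine Eq.trans ?_ (he y hy u).symm
      simp [u]
  -- differentiability of the orbit curve in `P`
  have hexp : MDifferentiableAt 𝓘(ℝ, ℝ) IG (fun t : ℝ => lieExp IG (-(t • X))) 0 := by
    have h1 := ((exists_oneParameterCurve IG (-X)).choose_spec.2 0).mdifferentiableAt
    have h2 : (fun t : ℝ => lieExp IG (-(t • X))) = oneParameterCurve IG (-X) := by
      ext t; rw [← smul_neg, lieExp_smul]
    rw [h2]; exact h1
  have hdiff : MDifferentiableAt 𝓘(ℝ, ℝ) IP (fun t : ℝ => lieExp IG (-(t • X)) • y) 0 :=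
    MDifferentiableAt.comp (I' := IG.prod IP) (0 : ℝ)
      (f := fun t : ℝ => (lieExp IG (-(t • X)), y)) (g := fun q : G × P => q.1 • q.2)
      (hp.contMDiff_action.mdifferentiable (by simp) _)
      (hexp.prodMk mdifferentiableAt_const)
  have hfund : ∀ u : Circle, Ξ (u • y) (fundamentalVectorField IP IG X (u • y))
      = Ξ y (fundamentalVectorField IP IG X y) := by
    intro u
    have hu : MDifferentiable IP IP (fun z : P => u • z) :=
      ((hp.contMDiff_smul).comp (contMDiff_const.prodMk contMDiff_id)).mdifferentiable
        (by simp)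
    have e1 : (fun t : ℝ => lieExp IG (-(t • X)) • u • y)
        = (fun z : P => u • z) ∘ (fun t : ℝ => lieExp IG (-(t • X)) • y) := by
      ext t; exact hp.action_comm _ _ _
    rw [← hΞ.invariant u y]
    unfold fundamentalVectorField
    rw [e1, mfderiv_comp (I' := IP) _ (hu _) hdiff]
    have e0 : lieExp IG (-((0 : ℝ) • X)) • y = y := by
      rw [← smul_neg, lieExp_smul]
      have := (exists_oneParameterCurve IG (-X)).choose_spec.1
      unfold oneParameterCurve
      rw [this, one_smul]
    have e2 : ∀ (z : P) (w : EP), z = y →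
        (mfderiv IP IP (fun z : P => u • z) z : EP →L[ℝ] EP) w
          = (mfderiv IP IP (fun z : P => u • z) y : EP →L[ℝ] EP) w := by
      rintro z w rfl; rfl
    exact congrArg (Ξ (u • y)) (e2 _ _ e0)
  obtain ⟨u, hu⟩ := hfib _ (hp.exists_proj_eq (p y)).choose_spec
  have him := hΞ.imaginary y (fundamentalVectorField IP IG X y)
  unfold momentum
  rw [hu, hfund u]
  apply Complex.ext
  · simp
  · rw [Complex.ofReal_im]
    simp [Complex.mul_im, Complex.div_re, him]

end Bundle

end EquivariantHolonomy

/-! Fix `y` over `x` and let f(t) = exp(tX)·y, which projects onto the orbit curve. Since f(t + s) =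
exp(tX)·f(s) and Ξ is G-invariant, Ξ(f') is constant. The convention exp(-tX) for X_P gives f'(0) =
-X_P(y), so this constant is -2πiμ (`formSpeed_orbit`). By the Leibniz rule `formSpeed_exp_smul`,
rotating f by e^{iat} adds ia to Ξ(f'). With a = 2πμ the rotated curve is horizontal, and it ends at
exp(X)·y rotated by e^{2πiμ}.

The holonomy is defined through all piecewise C¹ horizontal lifts, so uniqueness of the end point is
also needed (`IsHorizontalLift.eq_one`). Two lifts from `y` differ by a phase in U(1). It is
continuous, and by the same Leibniz rule its derivative vanishes off a countable set, so it is
constant. -/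

noncomputable section EquivariantHolonomy

/-! ### Regularity of integral curves -/

section IntegralCurve

variable {E : Type*} [NormedAddCommGroup E] [NormedSpace ℝ E]
  {H : Type*} [TopologicalSpace H] {I : ModelWithCorners ℝ E H}
  {N : Type*} [TopologicalSpace N] [ChartedSpace H N] [IsManifold I 1 N]

/-- A global integral curve of a continuous vector field is of class `C¹`. -/
theorem IsMIntegralCurve.contMDiff_one {γ : ℝ → N} {v : (x : N) → TangentSpace I x}
    (hγ : IsMIntegralCurve γ v)
    (hv : Continuous (fun x : N => (⟨x, v x⟩ : TangentBundle I N))) :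
    ContMDiff 𝓘(ℝ, ℝ) I 1 γ := by
  intro t₀
  rw [contMDiffAt_iff_target]
  refine ⟨hγ.continuous.continuousAt, ContDiffAt.contMDiffAt ?_⟩
  set e := trivializationAt E (TangentSpace I) (γ t₀)
  have hopen : IsOpen (γ ⁻¹' (extChartAt I (γ t₀)).source) :=
    (isOpen_extChartAt_source _).preimage hγ.continuous
  have hmem : t₀ ∈ γ ⁻¹' (extChartAt I (γ t₀)).source := mem_extChartAt_source _
  -- In the fixed chart at `γ t₀` the velocity is the fibre coordinate of `v` along the curve, hence
  -- continuous in `t`; this upgrades differentiability to C¹.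
  have hd : ∀ t ∈ γ ⁻¹' (extChartAt I (γ t₀)).source,
      HasDerivAt (extChartAt I (γ t₀) ∘ γ) (e ⟨γ t, v (γ t)⟩).2 t := fun t ht => by
    have h := ((hγ.isMIntegralCurveOn univ).hasDerivWithinAt (t₀ := t₀) (mem_univ t) ht).hasDerivAt
      Filter.univ_mem
    exact h
  have hcont : ContinuousOn (fun t => (e ⟨γ t, v (γ t)⟩).2)
      (γ ⁻¹' (extChartAt I (γ t₀)).source) := by
    refine continuous_snd.comp_continuousOn (e.continuousOn.comp
      (hv.comp hγ.continuous).continuousOn fun t ht => ?_)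
    rw [e.source_eq]
    simpa [e] using ht
  refine ContDiffOn.contDiffAt ?_ (hopen.mem_nhds hmem)
  refine (contDiffOn_one_iff_derivWithin hopen.uniqueDiffOn).2
    ⟨fun t ht => (hd t ht).differentiableAt.differentiableWithinAt, hcont.congr fun t ht => ?_⟩
  rw [derivWithin_of_isOpen hopen ht, (hd t ht).deriv]

end IntegralCurve

/-! ### One-parameter subgroups -/

section Exponential

variable {EG : Type*} [NormedAddCommGroup EG] [NormedSpace ℝ EG]
  {HG : Type*} [TopologicalSpace HG] (IG : ModelWithCorners ℝ EG HG)
  {G : Type*} [TopologicalSpace G] [ChartedSpace HG G] [Group G] [LieGroup IG ∞ G]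

theorem IsMIntegralCurve.mul_left {X : GroupLieAlgebra IG G} {γ : ℝ → G}
    (hγ : IsMIntegralCurve (I := IG) γ (mulInvariantVectorField X)) (g : G) :
    IsMIntegralCurve (I := IG) (fun t => g * γ t) (mulInvariantVectorField X) := fun t => by
  have hL : HasMFDerivAt IG IG (fun k => g * k) (γ t) (mfderiv IG IG (fun k => g * k) (γ t)) :=
    ((contMDiff_mul_left (I := IG) (n := ∞) (a := g)).mdifferentiable (by simp) _).hasMFDerivAt
  have h1 := hL.comp t (hγ t)
  have h2 : (mfderiv IG IG (fun k => g * k) (γ t)).comp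
      ((1 : ℝ →L[ℝ] ℝ).smulRight (mulInvariantVectorField X (γ t)))
      = (1 : ℝ →L[ℝ] ℝ).smulRight (mulInvariantVectorField X (g * γ t)) := by
    apply ContinuousLinearMap.ext
    intro s
    rw [← mfderiv_mul_left_leftInvariantField]
    exact map_smul (mfderiv IG IG (fun k => g * k) (γ t)) s _
  exact h2 ▸ h1

variable [FiniteDimensional ℝ EG] [T2Space G] [BoundarylessManifold IG G]

theorem oneParameterCurve_zero (X : GroupLieAlgebra IG G) : oneParameterCurve IG X 0 = 1 :=
  (exists_oneParameterCurve IG X).choose_spec.1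

theorem isMIntegralCurve_oneParameterCurve (X : GroupLieAlgebra IG G) :
    IsMIntegralCurve (I := IG) (oneParameterCurve IG X) (mulInvariantVectorField X) :=
  (exists_oneParameterCurve IG X).choose_spec.2

theorem contMDiff_oneParameterCurve (X : GroupLieAlgebra IG G) :
    ContMDiff 𝓘(ℝ, ℝ) IG 1 (oneParameterCurve IG X) :=
  have : IsManifold IG 1 G := inferInstance
  (isMIntegralCurve_oneParameterCurve IG X).contMDiff_one
    (contMDiff_leftInvariantField IG X).continuous

/-- As functions of `t`, both sides are integral curves of the same left-invariant field, one by
time shift and the other by left translation. They agree at `t = 0`, so uniqueness of integral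
curves applies. -/
theorem oneParameterCurve_add (X : GroupLieAlgebra IG G) (s t : ℝ) :
    oneParameterCurve IG X (s + t) = oneParameterCurve IG X s * oneParameterCurve IG X t := by
  have : IsManifold IG 1 G := inferInstance
  have : CompleteSpace EG := FiniteDimensional.complete ℝ EG
  have h := isMIntegralCurve_oneParameterCurve IG X
  have h4 := isMIntegralCurve_Ioo_eq_of_contMDiff_boundaryless (t₀ := (0 : ℝ))
    (contMDiff_leftInvariantField IG (G := G) X) (h.comp_add s)
    (h.mul_left IG (oneParameterCurve IG X s)) (by simp [oneParameterCurve_zero])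
  simpa [add_comm] using congrFun h4 t

end Exponential

section Bundle

variable {EM : Type*} [NormedAddCommGroup EM] [NormedSpace ℝ EM]
  {HM : Type*} [TopologicalSpace HM] {IM : ModelWithCorners ℝ EM HM}
  {M : Type*} [TopologicalSpace M] [ChartedSpace HM M]
  {EP : Type*} [NormedAddCommGroup EP] [NormedSpace ℝ EP]
  {HP : Type*} [TopologicalSpace HP] {IP : ModelWithCorners ℝ EP HP}
  {P : Type*} [TopologicalSpace P] [ChartedSpace HP P]

/-! ### Evaluating a 1-form on velocities -/

section Speed

variable (Ξ : (y : P) → TangentSpace IP y →L[ℝ] ℂ)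

/-- The value `Ξ(ċ(t))` of a 1-form on the velocity of a curve. -/
def formSpeed (c : ℝ → P) (t : ℝ) : ℂ := Ξ (c t) (mfderiv 𝓘(ℝ, ℝ) IP c t (1 : ℝ))

theorem formSpeed_congr {c c' : ℝ → P} {t : ℝ} (h : c =ᶠ[nhds t] c') :
    formSpeed Ξ c t = formSpeed Ξ c' t := by
  -- All tangent spaces unfold to `EP`, so stating the equality there lets the base point be
  -- substituted without casts between fibres.
  have key : ∀ (y z : P) (v w : EP), y = z → v = w →
      (Ξ y : EP →L[ℝ] ℂ) v = (Ξ z : EP →L[ℝ] ℂ) w := by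
    rintro y _ v _ rfl rfl; rfl
  exact key _ _ _ _ h.eq_of_nhds (by rw [h.mfderiv_eq]; rfl)

/-- Chain rule, needed for time shifts and for the reversal `s ↦ -s` behind the sign of X_P. -/
theorem formSpeed_comp {c : ℝ → P} {r : ℝ → ℝ} {t r' : ℝ}
    (hc : MDifferentiableAt 𝓘(ℝ, ℝ) IP c (r t)) (hr : HasDerivAt r r' t) :
    formSpeed Ξ (fun s => c (r s)) t = r' * formSpeed Ξ c (r t) := by
  have h : mfderiv 𝓘(ℝ, ℝ) IP (c ∘ r) t (1 : ℝ)
      = r' • mfderiv 𝓘(ℝ, ℝ) IP c (r t) (1 : ℝ) := by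
    have hr1 : mfderiv 𝓘(ℝ, ℝ) 𝓘(ℝ, ℝ) r t (1 : ℝ) = r' • (1 : ℝ) := by
      rw [mfderiv_eq_fderiv, smul_eq_mul, mul_one]
      exact hr.deriv
    rw [mfderiv_comp (I' := 𝓘(ℝ, ℝ)) t hc hr.differentiableAt.mdifferentiableAt]
    exact (congrArg (mfderiv 𝓘(ℝ, ℝ) IP c (r t)) hr1).trans
      (map_smul (mfderiv 𝓘(ℝ, ℝ) IP c (r t)) r' (1 : ℝ))
  have h' := congrArg (Ξ (c (r t))) h
  refine h'.trans ?_
  rw [map_smul, Complex.real_smul]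
  rfl

theorem formSpeed_comp_map {F : P → P} {c : ℝ → P} {t : ℝ}
    (hF : MDifferentiableAt IP IP F (c t)) (hc : MDifferentiableAt 𝓘(ℝ, ℝ) IP c t)
    (hinv : ∀ v : TangentSpace IP (c t), Ξ (F (c t)) (mfderiv IP IP F (c t) v) = Ξ (c t) v) :
    formSpeed Ξ (fun s => F (c s)) t = formSpeed Ξ c t := by
  have h : mfderiv 𝓘(ℝ, ℝ) IP (F ∘ c) t (1 : ℝ)
      = mfderiv IP IP F (c t) (mfderiv 𝓘(ℝ, ℝ) IP c t (1 : ℝ)) := by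
    rw [mfderiv_comp (I' := IP) t hF hc]; rfl
  exact (congrArg (Ξ (F (c t))) h).trans (hinv _)

end Speed

variable [MulAction Circle P] {p : P → M}

/-! ### Fibres of the circle bundle and phases between curves -/

namespace IsPrincipalCircleBundle

variable (hp : IsPrincipalCircleBundle IM IP p)
include hp

theorem contMDiff_const_smul (u : Circle) : ContMDiff IP IP ∞ (fun y : P => u • y) :=
  hp.contMDiff_smul.comp (contMDiff_const.prodMk contMDiff_id)

theorem contMDiff_exp_smul :
    ContMDiff (𝓘(ℝ, ℝ).prod IP) IP ∞ (fun q : ℝ × P => Circle.exp q.1 • q.2) :=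
  hp.contMDiff_smul.comp ((contMDiff_circleExp.comp contMDiff_fst).prodMk contMDiff_snd)

theorem contMDiff_proj : ContMDiff IP IM ∞ p := by
  intro y
  obtain ⟨e, hx, he, -, -⟩ := hp.locally_trivial (p y)
  have hy : y ∈ e.source := by rw [e.source_eq]; exact hx
  have h1 : ContMDiffOn IP IM ∞ (fun z => (e.toOpenPartialHomeomorph z).1) e.source :=
    contMDiff_fst.comp_contMDiffOn he
  exact (h1.congr fun z hz => (e.proj_toFun z hz).symm).contMDiffAt
    (e.open_source.mem_nhds hy)

/-- Transitivity on fibres: the quotient of the circle coordinates in a trivialization is the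
required element. -/
theorem exists_smul_eq {y z : P} (hz : p z = p y) : ∃ u : Circle, z = u • y := by
  obtain ⟨e, hx, -, -, he⟩ := hp.locally_trivial (p y)
  have hy : y ∈ e.source := by rw [e.source_eq]; exact hx
  have hzs : z ∈ e.source := by rw [e.source_eq, mem_preimage, hz]; exact hx
  set u : Circle := (e.toOpenPartialHomeomorph z).2 * (e.toOpenPartialHomeomorph y).2⁻¹
  have hus : u • y ∈ e.source := by
    rw [e.source_eq, mem_preimage, hp.proj_smul]; exact hx
  refine ⟨u, e.injOn hzs hus (Prod.ext ?_ ?_)⟩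
  · exact (e.proj_toFun z hzs).trans
      (hz.trans ((hp.proj_smul u y).symm.trans (e.proj_toFun _ hus).symm))
  · refine Eq.trans ?_ (he y hy u).symm
    simp [u]

theorem smul_right_cancel {u v : Circle} {y : P} (h : u • y = v • y) : u = v := by
  obtain ⟨e, hx, -, -, he⟩ := hp.locally_trivial (p y)
  have hy : y ∈ e.source := by rw [e.source_eq]; exact hx
  have h1 := he y hy u
  rw [h, he y hy v] at h1
  exact (mul_right_cancel h1).symm

/-- Near a time `t`, the phase between two continuous curves with the same projection is read off
in a trivialization. -/
theorem exists_phase_eq {b c : ℝ → P} {u : ℝ → Circle} (hb : Continuous b)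
    (hu : ∀ t, c t = u t • b t) (t : ℝ) :
    ∃ e : Trivialization Circle p, b t ∈ e.source ∧ c t ∈ e.source ∧
      ContMDiffOn IP (IM.prod (𝓡 1)) ∞ e.toOpenPartialHomeomorph e.source ∧
      u =ᶠ[nhds t] fun s => (e.toOpenPartialHomeomorph (c s)).2 *
        (e.toOpenPartialHomeomorph (b s)).2⁻¹ := by
  obtain ⟨e, hx, hes, -, he⟩ := hp.locally_trivial (p (b t))
  have hbt : b t ∈ e.source := by rw [e.source_eq]; exact hx
  have hct : c t ∈ e.source := by
    rw [e.source_eq, mem_preimage, hu, hp.proj_smul]; exact hx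
  refine ⟨e, hbt, hct, hes, ?_⟩
  filter_upwards [hb.continuousAt.preimage_mem_nhds (e.open_source.mem_nhds hbt)] with s hs
  rw [hu s, he _ hs, mul_inv_cancel_right]

/-- The phase is only given pointwise, but locally it is a quotient of circle coordinates of `c` and
`b`, so it inherits their regularity. -/
theorem continuous_phase {b c : ℝ → P} {u : ℝ → Circle} (hb : Continuous b) (hc : Continuous c)
    (hu : ∀ t, c t = u t • b t) : Continuous u := by
  refine continuous_iff_continuousAt.2 fun t => ?_
  obtain ⟨e, hbt, hct, -, heq⟩ := hp.exists_phase_eq hb hu t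
  have h : ∀ {a : ℝ → P}, Continuous a → a t ∈ e.source →
      ContinuousAt (fun s => (e.toOpenPartialHomeomorph (a s)).2) t := fun {a} ha hat =>
    ContinuousAt.snd (ContinuousAt.comp (e.toOpenPartialHomeomorph.continuousAt hat)
      ha.continuousAt)
  exact ((h hc hct).mul (h hb hbt).inv).congr heq.symm

theorem differentiableAt_phase {b c : ℝ → P} {u : ℝ → Circle} (hb : Continuous b)
    (hu : ∀ t, c t = u t • b t) {t : ℝ}
    (hbt : MDifferentiableAt 𝓘(ℝ, ℝ) IP b t) (hct : MDifferentiableAt 𝓘(ℝ, ℝ) IP c t) :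
    DifferentiableAt ℝ (fun s => (u s : ℂ)) t := by
  obtain ⟨e, hbe, hce, hes, heq⟩ := hp.exists_phase_eq hb hu t
  have hcoe : ContMDiff (𝓡 1) 𝓘(ℝ, ℂ) ∞ (fun z : Circle => (z : ℂ)) :=
    have : Fact (Module.finrank ℝ ℂ = 1 + 1) := finrank_real_complex_fact'
    contMDiff_coe_sphere
  have h : ∀ {a : ℝ → P}, MDifferentiableAt 𝓘(ℝ, ℝ) IP a t → a t ∈ e.source →
      DifferentiableAt ℝ (fun s => ((e.toOpenPartialHomeomorph (a s)).2 : ℂ)) t := by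
    intro a ha hat
    have h1 : MDifferentiableAt IP (IM.prod (𝓡 1)) e.toOpenPartialHomeomorph (a t) :=
      (hes.contMDiffAt (e.open_source.mem_nhds hat)).mdifferentiableAt (by simp)
    have h2 := (hcoe.mdifferentiableAt (by simp)).comp (a t)
      (mdifferentiableAt_snd.comp (a t) h1)
    exact (h2.comp t ha).differentiableAt
  have hinv : DifferentiableAt ℝ
      (fun s => ((e.toOpenPartialHomeomorph (b s)).2 : ℂ)⁻¹) t :=
    (h hbt hbe).inv (Circle.coe_ne_zero _)
  refine ((h hct hce).mul hinv).congr_of_eventuallyEq ?_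
  filter_upwards [heq] with s hs
  rw [hs]
  simp

end IsPrincipalCircleBundle

variable [IsManifold IP ∞ P]

/-- Leibniz rule for a connection form along the product of a curve in `U(1)` and a curve
in `P`. -/
theorem formSpeed_exp_smul (hp : IsPrincipalCircleBundle IM IP p)
    {Ξ : (y : P) → TangentSpace IP y →L[ℝ] ℂ} (hΞ : IsConnectionForm IP Ξ)
    {r : ℝ → ℝ} {b : ℝ → P} {t r' : ℝ} (hr : HasDerivAt r r' t)
    (hb : MDifferentiableAt 𝓘(ℝ, ℝ) IP b t) :
    formSpeed Ξ (fun s => Circle.exp (r s) • b s) t = r' * Complex.I + formSpeed Ξ b t := by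
  -- subtract the value at `t`, which acts by an automorphism preserving `Ξ`
  set q : ℝ → ℝ := fun s => r s - r t
  have hq : HasDerivAt q r' t := hr.sub_const _
  have hqt : q t = 0 := sub_self _
  have hF := hp.contMDiff_exp_smul
  have hpair : MDifferentiableAt 𝓘(ℝ, ℝ) (𝓘(ℝ, ℝ).prod IP) (fun s => (q s, b s)) t :=
    hq.differentiableAt.mdifferentiableAt.prodMk hb
  have hd : MDifferentiableAt 𝓘(ℝ, ℝ) IP (fun s => Circle.exp (q s) • b s) t :=
    MDifferentiableAt.comp (I' := 𝓘(ℝ, ℝ).prod IP) t (f := fun s => (q s, b s))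
      (g := fun z : ℝ × P => Circle.exp z.1 • z.2) (hF.mdifferentiable (by simp) _) hpair
  have e1 : (fun s => Circle.exp (r s) • b s)
      = fun s => Circle.exp (r t) • Circle.exp (q s) • b s := by
    ext s; rw [smul_smul, ← Circle.exp_add]; simp [q]
  rw [e1, formSpeed_comp_map Ξ (F := fun y => Circle.exp (r t) • y)
    ((hp.contMDiff_const_smul _).mdifferentiable (by simp) _) hd (hΞ.invariant _ _)]
  let F : ℝ × P → P := fun z => Circle.exp z.1 • z.2
  let B : ℝ →L[ℝ] EP := mfderiv 𝓘(ℝ, ℝ) IP b t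
  -- `D` is the differential of the action at `(0, b t)`. Its partial derivatives are computed next:
  -- the vertical generator in the first variable, the identity in the second because `F (0, z) =
  -- z`.
  obtain ⟨D, hD⟩ : ∃ D : ℝ × EP →L[ℝ] EP, ∀ x, x = ((0 : ℝ), b t) →
      HasMFDerivAt (𝓘(ℝ, ℝ).prod IP) IP F x D :=
    ⟨mfderiv (𝓘(ℝ, ℝ).prod IP) IP F (0, b t), by
      rintro x rfl; exact (hF.mdifferentiable (by simp) _).hasMFDerivAt⟩
  have hq' : HasMFDerivAt 𝓘(ℝ, ℝ) 𝓘(ℝ, ℝ) q t (ContinuousLinearMap.toSpanSingleton ℝ r') :=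
    HasFDerivAt.hasMFDerivAt hq
  have h1 : D ((1 : ℝ), 0)
      = (mfderiv 𝓘(ℝ, ℝ) IP (fun s : ℝ => Circle.exp s • b t) 0 (1 : ℝ) : EP) := by
    have h := HasMFDerivAt.comp (0 : ℝ) (f := fun s : ℝ => (s, b t)) (hD _ rfl)
      ((hasMFDerivAt_id _).prodMk (hasMFDerivAt_const _ _))
    exact (congrArg (fun L : ℝ →L[ℝ] EP => L 1) h.mfderiv).symm
  have h2 : ∀ w : EP, D (0, w) = w := by
    have h := HasMFDerivAt.comp (b t) (f := fun z : P => ((0 : ℝ), z)) (hD _ rfl)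
      ((hasMFDerivAt_const _ _).prodMk (hasMFDerivAt_id _))
    have h0 : F ∘ (fun z : P => ((0 : ℝ), z)) = id := by
      ext z; simp [F]
    rw [h0] at h
    intro w
    exact congrArg (fun L : EP →L[ℝ] EP => L w) (hasMFDerivAt_unique h (hasMFDerivAt_id _))
  have h3 : (mfderiv 𝓘(ℝ, ℝ) IP (fun s => Circle.exp (q s) • b s) t (1 : ℝ) : EP)
      = D (r', B 1) := by
    have h := HasMFDerivAt.comp t (f := fun s => (q s, b s)) (hD _ (by rw [hqt]))
      (hq'.prodMk hb.hasMFDerivAt)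
    refine (congrArg (fun L : ℝ →L[ℝ] EP => L 1) h.mfderiv).trans ?_
    change D ((1 : ℝ) • r', B 1) = _
    rw [one_smul]
  have hsplit : ((r', B 1) : ℝ × EP) = r' • ((1 : ℝ), (0 : EP)) + (0, B 1) := by simp
  rw [hsplit, map_add, map_smul, h1, h2] at h3
  have key : ∀ (y z : P) (v : EP), y = z →
      (Ξ y : EP →L[ℝ] ℂ) v = (Ξ z : EP →L[ℝ] ℂ) v := by
    rintro y _ v rfl; rfl
  have e2 : Circle.exp (q t) • b t = b t := by rw [hqt, Circle.exp_zero, one_smul]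
  have e3 : (Ξ (b t) : EP →L[ℝ] ℂ)
      (mfderiv 𝓘(ℝ, ℝ) IP (fun s : ℝ => Circle.exp s • b t) 0 (1 : ℝ) : EP) = Complex.I :=
    hΞ.vertical (b t)
  refine (key _ _ _ e2).trans ?_
  refine (congrArg (Ξ (b t) : EP →L[ℝ] ℂ) h3).trans ?_
  refine (map_add (Ξ (b t) : EP →L[ℝ] ℂ) _ _).trans (congrArg₂ (· + ·) ?_ rfl)
  exact (map_smul (Ξ (b t) : EP →L[ℝ] ℂ) r' _).trans
    ((congrArg (r' • ·) e3).trans Complex.real_smul)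

end Bundle

/-! ### Piecewise C¹ curves and well-definedness of the holonomy -/

section Bundle

variable {EM : Type*} [NormedAddCommGroup EM] [NormedSpace ℝ EM]
  {HM : Type*} [TopologicalSpace HM] {IM : ModelWithCorners ℝ EM HM}
  {M : Type*} [TopologicalSpace M] [ChartedSpace HM M]
  {EP : Type*} [NormedAddCommGroup EP] [NormedSpace ℝ EP]
  {HP : Type*} [TopologicalSpace HP] {IP : ModelWithCorners ℝ EP HP}
  {P : Type*} [TopologicalSpace P] [ChartedSpace HP P]

theorem IsPiecewiseC1.exists_countable_mdifferentiableAt {c : unitInterval → M}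
    (hc : IsPiecewiseC1 IM c) :
    ∃ S : Set ℝ, S.Countable ∧ ∀ t ∈ Ioo (0 : ℝ) 1 \ S,
      MDifferentiableAt 𝓘(ℝ, ℝ) IM (IccExtend zero_le_one c) t := by
  obtain ⟨-, n, T, h0, hn, hT⟩ := hc
  refine ⟨range T, countable_range T, fun t ht => ?_⟩
  have hex : ∃ k, t ≤ T k := ⟨n, hn ▸ ht.1.2.le⟩
  classical
  -- The first partition point not below `t` has positive index since `t > 0 = T 0`; as `t` is not
  -- itself a partition point, it lies strictly between `T k` and `T (k + 1)`.
  obtain ⟨k, hk⟩ : ∃ k, Nat.find hex = k + 1 := Nat.exists_eq_succ_of_ne_zero fun h => by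
    have := Nat.find_spec hex
    rw [h, h0] at this
    exact absurd ht.1.1 this.not_gt
  have h1 : t < T (k + 1) :=
    lt_of_le_of_ne (hk ▸ Nat.find_spec hex) fun h => ht.2 ⟨_, h.symm⟩
  have h2 : T k < t := not_le.1 (Nat.find_min hex (by omega))
  have hkn : k < n := by
    have := Nat.find_min' hex (hn ▸ ht.1.2.le : t ≤ T n)
    omega
  exact ((hT k hkn).2.contMDiffAt (Icc_mem_nhds h2 h1)).mdifferentiableAt (by simp)

theorem ContMDiff.isPiecewiseC1 {f : ℝ → M} (hf : ContMDiff 𝓘(ℝ, ℝ) IM 1 f) :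
    IsPiecewiseC1 IM (fun s : unitInterval => f s) := by
  refine ⟨hf.continuous.comp continuous_subtype_val, 1, fun i => (i : ℝ), by simp, by simp,
    fun i hi => ?_⟩
  obtain rfl : i = 0 := by omega
  refine ⟨by simp, hf.contMDiffOn.congr fun t ht => ?_⟩
  simp only [Nat.cast_zero, zero_add, Nat.cast_one] at ht
  rw [IccExtend_of_mem _ _ ht]

variable [MulAction Circle P] {p : P → M}

/-- The existence clause of the definition is essential: some lift over the nonempty fibre pins down
the end point, and freeness of the action then pins down the phase. -/
theorem IsPrincipalCircleBundle.isEquivariantHolonomy_unique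
    {G : Type*} [Group G] [MulAction G P] (hp : IsPrincipalCircleBundle IM IP p)
    {Ξ : (y : P) → TangentSpace IP y →L[ℝ] ℂ} {φ : G}
    {γ : unitInterval → M} {u v : Circle} (hu : IsEquivariantHolonomy IP p Ξ φ γ u)
    (hv : IsEquivariantHolonomy IP p Ξ φ γ v) : u = v := by
  obtain ⟨y, hy⟩ := hp.exists_proj_eq (γ 0)
  obtain ⟨c, hc⟩ := (hu y hy).1
  exact hp.smul_right_cancel (((hu y hy).2 c hc).symm.trans ((hv y hy).2 c hc))

theorem IsPrincipalCircleBundle.equivariantHolonomy_eq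
    {G : Type*} [Group G] [MulAction G P] (hp : IsPrincipalCircleBundle IM IP p)
    {Ξ : (y : P) → TangentSpace IP y →L[ℝ] ℂ} {φ : G}
    {γ : unitInterval → M} {u : Circle} (hu : IsEquivariantHolonomy IP p Ξ φ γ u) :
    equivariantHolonomy IP p Ξ φ γ = u := by
  have h : ∃ u : Circle, IsEquivariantHolonomy IP p Ξ φ γ u := ⟨u, hu⟩
  rw [equivariantHolonomy, dif_pos h]
  exact hp.isEquivariantHolonomy_unique h.choose_spec hu

section Orbit

variable {EG : Type*} [NormedAddCommGroup EG] [NormedSpace ℝ EG] [FiniteDimensional ℝ EG]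
  {HG : Type*} [TopologicalSpace HG] {IG : ModelWithCorners ℝ EG HG}
  {G : Type*} [TopologicalSpace G] [ChartedSpace HG G] [Group G] [LieGroup IG ∞ G]
  [T2Space G] [BoundarylessManifold IG G] [MulAction G M] [MulAction G P]

theorem IsEquivariantCircleBundle.contMDiff_orbit
    (hp : IsEquivariantCircleBundle IM IP IG G p) (X : GroupLieAlgebra IG G) (y : P) :
    ContMDiff 𝓘(ℝ, ℝ) IP 1 (fun t : ℝ => oneParameterCurve IG X t • y) :=
  (hp.contMDiff_action.of_le (by simp)).comp
    ((contMDiff_oneParameterCurve IG X).prodMk contMDiff_const)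

theorem IsEquivariantCircleBundle.orbitCurve_mem_equivariantCurves
    (hp : IsEquivariantCircleBundle IM IP IG G p) (X : GroupLieAlgebra IG G) (x : M) :
    orbitCurve IG X x ∈ equivariantCurves IM (lieExp IG X) x := by
  obtain ⟨y, rfl⟩ := hp.exists_proj_eq x
  have h0 : orbitCurve IG X (p y) 0 = p y := by
    rw [orbitCurve, lieExp_smul]; simp [oneParameterCurve_zero]
  -- Only the action on `P` is assumed smooth, so the regularity of the orbit in `M` is obtained by
  -- projecting an orbit in `P`.
  have h1 : orbitCurve IG X (p y) =
      fun s : unitInterval => p (oneParameterCurve IG X s • y) := by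
    ext s; rw [orbitCurve, lieExp_smul, hp.proj_action]
  refine ⟨?_, ?_, h0⟩
  · rw [h1]
    exact ContMDiff.isPiecewiseC1
      ((hp.contMDiff_proj.of_le (by simp)).comp (hp.contMDiff_orbit X y))
  · rw [h0]; simp [orbitCurve]

end Orbit

variable [IsManifold IP ∞ P]

/-- The phase between two horizontal curves with the same projection is locally constant. -/
theorem IsPrincipalCircleBundle.hasDerivAt_phase (hp : IsPrincipalCircleBundle IM IP p)
    {Ξ : (y : P) → TangentSpace IP y →L[ℝ] ℂ} (hΞ : IsConnectionForm IP Ξ)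
    {b c : ℝ → P} {u : ℝ → Circle} (hb : Continuous b)
    (hu : ∀ t, c t = u t • b t) {t : ℝ} (hbt : MDifferentiableAt 𝓘(ℝ, ℝ) IP b t)
    (hct : MDifferentiableAt 𝓘(ℝ, ℝ) IP c t) (hb0 : formSpeed Ξ b t = 0)
    (hc0 : formSpeed Ξ c t = 0) : HasDerivAt (fun s => (u s : ℂ)) 0 t := by
  have hd := hp.differentiableAt_phase hb hu hbt hct
  -- Dividing by `u t` puts the value at `s = t` at 1, inside the slit plane, so this logarithm is
  -- differentiable there; the identity `hexp` holds for all `s` regardless of the branch.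
  set r : ℝ → ℝ := fun s => Complex.arg ((u s / u t : Circle) : ℂ)
  have hr : DifferentiableAt ℝ r t := by
    have h1 : DifferentiableAt ℝ (fun s => ((u s / u t : Circle) : ℂ)) t := by
      simpa only [Circle.coe_div] using hd.div_const (u t : ℂ)
    have h2 := h1.hasDerivAt.clog_real (by simp [Complex.slitPlane])
    have h3 := (Complex.imCLM.hasFDerivAt.comp_hasDerivAt t h2).differentiableAt
    simpa only [r, Function.comp_def, Complex.imCLM_apply, Complex.log_im] using h3
  have hexp : ∀ s, u s = u t * Circle.exp (r s) := fun s => by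
    simp only [r, Circle.exp_arg, mul_div_cancel]
  have hcr : c = fun s => Circle.exp (r s) • u t • b s := by
    ext s; rw [smul_smul, mul_comm, ← hexp, hu]
  have hut := (hp.contMDiff_const_smul (u t)).mdifferentiable (by simp)
  have hspeed := formSpeed_exp_smul hp hΞ hr.hasDerivAt ((hut (b t)).comp t hbt)
  have h0 : formSpeed Ξ (fun s => u t • b s) t = 0 :=
    (formSpeed_comp_map Ξ (hut (b t)) hbt (hΞ.invariant _ _)).trans hb0
  -- Both curves are horizontal, so the Leibniz rule reduces to `0 = r' * I`.
  have hr0 : deriv r t = 0 := by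
    have : formSpeed Ξ c t = deriv r t * Complex.I + formSpeed Ξ (fun s => u t • b s) t := by
      rw [hcr]; exact hspeed
    rw [hc0, h0, add_zero] at this
    simpa using this.symm
  have hr' : HasDerivAt r 0 t := hr0 ▸ hr.hasDerivAt
  have hU : (fun s => (u s : ℂ)) = fun s => (u t : ℂ) * Complex.exp (r s * Complex.I) := by
    ext s; rw [hexp s]; simp
  rw [hU]
  simpa using ((hr'.ofReal_comp.mul_const Complex.I).cexp).const_mul (u t : ℂ)

/-- Horizontal lifts with the same starting point have the same end point. -/
theorem IsHorizontalLift.eq_one (hp : IsPrincipalCircleBundle IM IP p)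
    {Ξ : (y : P) → TangentSpace IP y →L[ℝ] ℂ} (hΞ : IsConnectionForm IP Ξ)
    {γ : unitInterval → M} {y : P} {b c : unitInterval → P}
    (hb : IsHorizontalLift IP p Ξ γ y b) (hc : IsHorizontalLift IP p Ξ γ y c) : c 1 = b 1 := by
  have hfib : ∀ t : ℝ, ∃ u : Circle,
      IccExtend zero_le_one c t = u • IccExtend zero_le_one b t := fun t =>
    hp.exists_smul_eq ((hc.proj _).trans (hb.proj _).symm)
  choose u hu using hfib
  obtain ⟨S, hS, hbS⟩ := hb.piecewiseC1.exists_countable_mdifferentiableAt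
  obtain ⟨T, hT, hcT⟩ := hc.piecewiseC1.exists_countable_mdifferentiableAt
  have hbc : Continuous (IccExtend zero_le_one b) := hb.piecewiseC1.1.Icc_extend'
  have hcc : Continuous (IccExtend zero_le_one c) := hc.piecewiseC1.1.Icc_extend'
  have hcont : Continuous fun t => (u t : ℂ) :=
    continuous_subtype_val.comp (hp.continuous_phase hbc hcc hu)
  -- The fundamental theorem of calculus tolerates the countably many points where a lift may fail
  -- to be differentiable, because the phase is continuous there.
  have hint := MeasureTheory.integral_eq_of_hasDerivAt_off_countable (a := 0) (b := 1)
    (fun t => (u t : ℂ)) (fun _ => 0) (hS.union hT) hcont.continuousOn (fun t ht => by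
      rw [min_eq_left zero_le_one, max_eq_right zero_le_one] at ht
      have hbt := hbS t ⟨ht.1, fun h => ht.2 (Or.inl h)⟩
      have hct := hcT t ⟨ht.1, fun h => ht.2 (Or.inr h)⟩
      exact hp.hasDerivAt_phase hΞ hbc hu hbt hct (hb.horizontal t ht.1 hbt)
        (hc.horizontal t ht.1 hct)) (by simp)
  have h10 : u 1 = u 0 := by
    rw [intervalIntegral.integral_zero] at hint
    exact Circle.ext (sub_eq_zero.1 hint.symm)
  have h0 : u 0 = 1 := by
    refine hp.smul_right_cancel (y := y) ?_
    have := hu 0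
    rw [IccExtend_left, IccExtend_left] at this
    rw [one_smul]
    exact (congrArg (u 0 • ·) hb.initial).symm.trans (this.symm.trans hc.initial)
  have h1 := hu 1
  rw [IccExtend_right, IccExtend_right, h10, h0, one_smul] at h1
  exact h1

variable {EG : Type*} [NormedAddCommGroup EG] [NormedSpace ℝ EG] [FiniteDimensional ℝ EG]
  {HG : Type*} [TopologicalSpace HG] {IG : ModelWithCorners ℝ EG HG}
  {G : Type*} [TopologicalSpace G] [ChartedSpace HG G] [Group G] [LieGroup IG ∞ G]
  [T2Space G] [BoundarylessManifold IG G] [MulAction G M] [MulAction G P]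

/-! ### Horizontal lift and holonomy of orbit curves -/

namespace IsEquivariantCircleBundle

variable (hp : IsEquivariantCircleBundle IM IP IG G p)
include hp

/-- Shifting time along the orbit is the action of a group element, which preserves Ξ, so the value
at time 0 suffices; there the velocity is minus the fundamental vector. -/
theorem formSpeed_orbit {Ξ : (y : P) → TangentSpace IP y →L[ℝ] ℂ} (hΞ : IsConnectionForm IP Ξ)
    (hinv : IsInvariantForm IP G Ξ) (X : GroupLieAlgebra IG G) (y : P) (t : ℝ) :
    formSpeed Ξ (fun t : ℝ => oneParameterCurve IG X t • y) t
      = -(2 * Real.pi * momentum IM IP IG hp Ξ X (p y) : ℝ) * Complex.I := by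
  have hf := (hp.contMDiff_orbit X y).mdifferentiable (by simp)
  set f : ℝ → P := fun t : ℝ => oneParameterCurve IG X t • y
  have hf0 : f 0 = y := by simp [f, oneParameterCurve_zero]
  have hconst : formSpeed Ξ f t = formSpeed Ξ f 0 := by
    have h1 : formSpeed Ξ (fun s => f (t + s)) 0 = formSpeed Ξ f t := by
      have := formSpeed_comp Ξ (c := f) (r := fun s => t + s) (t := 0) (hf _)
        ((hasDerivAt_id (0 : ℝ)).const_add t)
      simpa using this
    have h2 : (fun s => f (t + s)) = fun s => oneParameterCurve IG X t • f s := by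
      ext s; simp only [f]; rw [oneParameterCurve_add, mul_smul]
    rw [← h1, h2]
    have hg : ContMDiff IP IP ∞ (fun z : P => oneParameterCurve IG X t • z) :=
      hp.contMDiff_action.comp (contMDiff_const.prodMk contMDiff_id)
    exact formSpeed_comp_map Ξ (hg.mdifferentiable (by simp) _) (hf 0) (hinv _ _)
  have hfund : Ξ y (fundamentalVectorField IP IG X y) = -formSpeed Ξ f 0 := by
    have h1 : formSpeed Ξ (fun s => f (-s)) 0 = -formSpeed Ξ f 0 := by
      have := formSpeed_comp Ξ (c := f) (r := fun s => -s) (t := 0) (hf _) (hasDerivAt_neg 0)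
      simpa using this
    have h2 : (fun s : ℝ => lieExp IG (-(s • X)) • y) = fun s => f (-s) := by
      ext s; rw [← neg_smul, lieExp_smul]
    have key : ∀ (y z : P) (v : EP), y = z →
        (Ξ y : EP →L[ℝ] ℂ) v = (Ξ z : EP →L[ℝ] ℂ) v := by
      rintro y _ v rfl; rfl
    rw [← h1, fundamentalVectorField, h2]
    exact key _ _ _ (by simp [hf0])
  have hμ := momentum_proj IM IP IG hp hΞ X y
  rw [hfund] at hμ
  have hpi : (Real.pi : ℂ) ≠ 0 := by exact_mod_cast Real.pi_ne_zero
  rw [hconst]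
  push_cast
  rw [hμ]
  field_simp
  rw [Complex.I_sq]
  ring

/-- The horizontal lift of an orbit curve. -/
theorem isHorizontalLift_orbitCurve {Ξ : (y : P) → TangentSpace IP y →L[ℝ] ℂ}
    (hΞ : IsConnectionForm IP Ξ) (hinv : IsInvariantForm IP G Ξ) (X : GroupLieAlgebra IG G)
    (y : P) :
    IsHorizontalLift IP p Ξ (orbitCurve IG X (p y)) y (fun s =>
      Circle.exp (2 * Real.pi * momentum IM IP IG hp Ξ X (p y) * s) •
        oneParameterCurve IG X s • y) := by
  -- The rotation rate whose contribution `a * I` cancels the constant value of Ξ on the orbit's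
  -- velocity.
  set a : ℝ := 2 * Real.pi * momentum IM IP IG hp Ξ X (p y)
  have hf := hp.contMDiff_orbit X y
  have hlin : ContMDiff 𝓘(ℝ, ℝ) 𝓘(ℝ, ℝ) 1 (fun s : ℝ => a * s) :=
    (contDiff_const.mul contDiff_id).contMDiff
  have hc : ContMDiff 𝓘(ℝ, ℝ) IP 1
      (fun s : ℝ => Circle.exp (a * s) • oneParameterCurve IG X s • y) :=
    (hp.contMDiff_exp_smul.of_le (by simp)).comp (hlin.prodMk hf)
  refine ⟨hc.isPiecewiseC1, fun t => ?_, by simp [oneParameterCurve_zero], fun t ht _ => ?_⟩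
  · rw [hp.proj_smul, hp.proj_action, orbitCurve, lieExp_smul]
  · have heq : IccExtend zero_le_one (fun s : unitInterval =>
        Circle.exp (a * s) • oneParameterCurve IG X s • y)
        =ᶠ[nhds t] fun s : ℝ => Circle.exp (a * s) • oneParameterCurve IG X s • y := by
      filter_upwards [Icc_mem_nhds ht.1 ht.2] with s hs
      rw [IccExtend_of_mem _ _ hs]
    refine (formSpeed_congr Ξ heq).trans ?_
    rw [formSpeed_exp_smul hp.toIsPrincipalCircleBundle hΞ (r := fun s => a * s) (r' := a)
      (by simpa using (hasDerivAt_id t).const_mul a) (hf.mdifferentiable (by simp) t),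
      hp.formSpeed_orbit hΞ hinv]
    ring

theorem isEquivariantHolonomy_orbitCurve {Ξ : (y : P) → TangentSpace IP y →L[ℝ] ℂ}
    (hΞ : IsConnectionForm IP Ξ) (hinv : IsInvariantForm IP G Ξ) (X : GroupLieAlgebra IG G)
    (x : M) :
    IsEquivariantHolonomy IP p Ξ (lieExp IG X) (orbitCurve IG X x)
      (Circle.exp (2 * Real.pi * momentum IM IP IG hp Ξ X x)) := by
  intro y hy
  obtain rfl : p y = x := hy.trans (hp.orbitCurve_mem_equivariantCurves X x).2.2
  have h := hp.isHorizontalLift_orbitCurve hΞ hinv X y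
  refine ⟨⟨_, h⟩, fun c hc => ?_⟩
  -- An arbitrary lift ends where the explicit one does; at `s = 1` the latter is the stated phase
  -- applied to `lieExp IG X • y`, by definition of `lieExp`.
  rw [h.eq_one hp.toIsPrincipalCircleBundle hΞ hc]
  simp [lieExp]

end IsEquivariantCircleBundle

end Bundle

end EquivariantHolonomy

theorem mainTheorem4
    {EG : Type*} [NormedAddCommGroup EG] [NormedSpace ℝ EG] [FiniteDimensional ℝ EG]
    {HG : Type*} [TopologicalSpace HG] (IG : ModelWithCorners ℝ EG HG)
    {G : Type*} [TopologicalSpace G] [ChartedSpace HG G] [Group G] [LieGroup IG ∞ G]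
    [T2Space G] [BoundarylessManifold IG G]
    {EM : Type*} [NormedAddCommGroup EM] [NormedSpace ℝ EM] [FiniteDimensional ℝ EM]
    {HM : Type*} [TopologicalSpace HM] (IM : ModelWithCorners ℝ EM HM)
    {M : Type*} [TopologicalSpace M] [ChartedSpace HM M] [IsManifold IM ∞ M]
    [T2Space M] [BoundarylessManifold IM M]
    {EP : Type*} [NormedAddCommGroup EP] [NormedSpace ℝ EP] [FiniteDimensional ℝ EP]
    {HP : Type*} [TopologicalSpace HP] (IP : ModelWithCorners ℝ EP HP)
    {P : Type*} [TopologicalSpace P] [ChartedSpace HP P] [IsManifold IP ∞ P]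
    [T2Space P] [BoundarylessManifold IP P]
    [MulAction Circle P] [MulAction G M] [MulAction G P]
    (p : P → M) (hp : IsEquivariantCircleBundle IM IP IG G p)
    (Ξ : (y : P) → TangentSpace IP y →L[ℝ] ℂ)
    (hΞ : IsConnectionForm IP Ξ) (hinv : IsInvariantForm IP G Ξ)
    (X : GroupLieAlgebra IG G) (x : M) :
    orbitCurve IG X x ∈ equivariantCurves IM (lieExp IG X) x ∧
    IsEquivariantHolonomy IP p Ξ (lieExp IG X) (orbitCurve IG X x)
      (equivariantHolonomy IP p Ξ (lieExp IG X) (orbitCurve IG X x)) ∧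
    (equivariantHolonomy IP p Ξ (lieExp IG X) (orbitCurve IG X x) : ℂ) =
      Complex.exp (2 * Real.pi * Complex.I * (momentum IM IP IG hp Ξ X x : ℂ)) := by
  have h := hp.isEquivariantHolonomy_orbitCurve hΞ hinv X x
  rw [hp.toIsPrincipalCircleBundle.equivariantHolonomy_eq h]
  refine ⟨hp.orbitCurve_mem_equivariantCurves X x, h, ?_⟩
  rw [Circle.coe_exp]
  congr 1
  push_cast
  ring
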